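/- There is a universal constant $C>0$ such that the following holds for every integer $n\ge 2$ and every symmetric convex body $K\subseteq\mathbb{R}^n$, i.e. every nonempty compact convex set $K\subseteq\mathbb{R}^n$ with $-K=K$. There exists a real $n\times n$ matrix $F$ such that $K$ is contained in the ellipsoid $E=FB_2^n$, the image under $F$ of the closed Euclidean unit ball $B_2^n$, and $$\|F\|_{HS}\;\le\; (C\log n)\,\max_{1\le k\le n}\sqrt{k}\,d_k(K).$$ Here $\|F\|_{HS}=\bigl(\sum_{i,j}F_{ij}^2\bigr)^{1/2}$ is the Hilbert–Schmidt norm, and $$d_k(K)=\min_{\Pi\in\mathcal{P}_{n-k+1}}\ \max_{x\in K}\|\Pi x\|_2$$ is the $k$-th Kolmogorov width of $K$, where $\mathcal{P}_{j}$ denotes the set of orthogonal projections of $\mathbb{R}^n$ onto $j$-dimensional subspaces. -/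

import Mathlib

open scoped Pointwise Matrix.Norms.Frobenius

/-- The radius `max_{x ∈ K} ‖Π_W x‖₂` of the orthogonal projection of `K` onto the subspace `W`
(for nonempty bounded `K`; the supremum is attained when `K` is compact). -/
noncomputable def projRadius {n : ℕ} (K : Set (EuclideanSpace ℝ (Fin n)))
    (W : Submodule ℝ (EuclideanSpace ℝ (Fin n))) : ℝ :=
  sSup ((fun x => ‖W.starProjection x‖) '' K)

/-- The Kolmogorov width `d_k(K)`, `1 ≤ k ≤ n`: the minimum of the radius of the orthogonal
projection of `K` onto `W`, over all subspaces `W` of `ℝⁿ` of codimension `k - 1`,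
that is, of dimension `n - k + 1`. -/
noncomputable def kolmogorovWidth {n : ℕ} (k : ℕ) (K : Set (EuclideanSpace ℝ (Fin n))) : ℝ :=
  sInf (projRadius K '' {W | Module.finrank ℝ W + k = n + 1})

/-- The (centered) ellipsoid `F B_2ⁿ`, the image of the closed Euclidean unit ball under `F`. -/
noncomputable def ellipsoid {n : ℕ} (F : Matrix (Fin n) (Fin n) ℝ) :
    Set (EuclideanSpace ℝ (Fin n)) :=
  Matrix.toEuclideanLin F '' Metric.closedBall 0 1

open InnerProductSpace

/-! An ellipsoid containing `K` is found by duality. If a positive definite `A` has `⟪x, A x⟫ ≤ s`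
on `K`, then `F = √s A^(-1/2)` works, with `‖F‖² = s tr A⁻¹`. So one wants `A` making `⟪x, A x⟫ + tr
A⁻¹` small uniformly over `K`. Replacing `A⁻¹` by any `P ≥ A⁻¹` makes the problem affine over a
convex set (`inverseEpigraph`), and replacing `x` by the covariances `S` in the closed hull of the
`x ⊗ x` makes it a minimax problem.

By `exists_forall_lt_of_affine` it is enough to treat one `S` at a time, where `A = S^(-1/2)`
formally gives the value `2 tr √S`. The widths control the spectrum of `S`: a projection of small
radius on `K` captures little of `tr S`, so the `i`-th largest eigenvalue has square root at most
`2M/i`, where `M = max √k d_k(K)` (`eigenvalue_mul_le`, `sqrt_eigenvalue_le`). Summing the harmonic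
series gives the logarithm. -/

/-- A minimax principle for functions affine in each variable: if on a compact convex set `X` every
point admits some `y ∈ Y` with `f x y < c`, then a single `y ∈ Y` works for all of `X`. -/
theorem exists_forall_lt_of_affine {V W : Type*} [NormedAddCommGroup V] [NormedSpace ℝ V]
    [FiniteDimensional ℝ V] [NormedAddCommGroup W] [NormedSpace ℝ W] [FiniteDimensional ℝ W]
    (B : V →ₗ[ℝ] W →ₗ[ℝ] ℝ) (g : W →ₗ[ℝ] ℝ) {X : Set V} {Y : Set W} (hXc : IsCompact X)
    (hXn : X.Nonempty) (hX : Convex ℝ X) (hY : Convex ℝ Y) {c : ℝ}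
    (h : ∀ x ∈ X, ∃ y ∈ Y, B x y + g y < c) : ∃ y ∈ Y, ∀ x ∈ X, B x y + g y < c := by
  have hcx (y : W) : Continuous fun x => B x y + g y :=
    (LinearMap.continuous_of_finiteDimensional (B.flip y)).add continuous_const
  have hcy (x : V) : Continuous fun y => B x y + g y :=
    LinearMap.continuous_of_finiteDimensional (B x + g)
  choose! η hηY hη using h
  -- Strict inequality is open in `x`, so finitely many `y` serve all of `X`; Sion's theorem merges
  -- them into one.
  obtain ⟨t, htX, ht⟩ := hXc.elim_nhds_subcover (fun x => {z | B z (η x) + g (η x) < c})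
    fun x hx => (isOpen_lt (hcx (η x)) continuous_const).mem_nhds (hη x hx)
  have key := Sion.exists_lt_iInf_of_lt_iInf_of_finite (X := X) (Y := Y)
    (f := fun x y => -(B x y + g y)) (t := -c) hXn hXc
    (fun y _ => (hcx y).neg.lowerSemicontinuous.lowerSemicontinuousOn _)
    (fun y _ => ConvexOn.quasiconvexOn
      (((-B.flip y).convexOn hX).add_const (-(g y)) |>.congr fun x _ => by simp; ring)) hY
    (fun x _ => (hcy x).neg.upperSemicontinuous.upperSemicontinuousOn _)
    (fun x _ => ConcaveOn.quasiconcaveOn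
      (((-(B x + g)).concaveOn hY).congr fun y _ => by simp))
    hX (s := η '' t) (t.finite_toSet.image η) (by rintro _ ⟨x, hx, rfl⟩; exact hηY x (htX x hx))
    (by
      intro x hx
      obtain ⟨z, hz, hxz⟩ := Set.mem_iUnion₂.mp (ht hx)
      exact ⟨η z, ⟨z, hz, rfl⟩, neg_lt_neg hxz⟩)
  obtain ⟨y, hy, hlt⟩ := key
  exact ⟨y, hy, fun x hx => neg_lt_neg_iff.mp (hlt x hx)⟩

/-! ### Diagonal operators and pairs `P ≥ A⁻¹` -/

section InnerProduct

variable {E ι : Type*} [NormedAddCommGroup E] [InnerProductSpace ℝ E] [Fintype ι]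

theorem OrthonormalBasis.sum_sq_norm_starProjection [FiniteDimensional ℝ E]
    (b : OrthonormalBasis ι ℝ E) (W : Submodule ℝ E) :
    ∑ i, ‖W.starProjection (b i)‖ ^ 2 = Module.finrank ℝ W := by
  have h : LinearMap.IsProj W (W.starProjection : E →ₗ[ℝ] E) :=
    ⟨fun x => by simp, fun x hx => by simpa using W.starProjection_eq_self_iff.mpr hx⟩
  have h2 := h.trace
  rw [LinearMap.trace_eq_sum_inner _ b] at h2
  rw [← h2]
  refine Finset.sum_congr rfl fun i _ => ?_
  have := W.inner_starProjection_left_eq_right (b i) (W.starProjection (b i))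
  rw [← real_inner_self_eq_norm_sq, this,
    W.starProjection_eq_self_iff.mpr (W.starProjection_apply_mem _)]
  simp

/-- The operator that is diagonal in the orthonormal basis `u` with diagonal entries `a`. -/
noncomputable def diagonalOperator (u : OrthonormalBasis ι ℝ E) (a : ι → ℝ) : E →L[ℝ] E :=
  ∑ i, a i • rankOne ℝ (u i) (u i)

theorem diagonalOperator_apply_basis (u : OrthonormalBasis ι ℝ E) (a : ι → ℝ) (j : ι) :
    diagonalOperator u a (u j) = a j • u j := by
  classical
  simp [diagonalOperator, u.inner_eq_ite, ite_smul]

theorem inner_diagonalOperator (u : OrthonormalBasis ι ℝ E) (a : ι → ℝ) (x y : E) :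
    inner ℝ x (diagonalOperator u a y) = ∑ i, a i * (inner ℝ (u i) x * inner ℝ (u i) y) := by
  simp only [diagonalOperator, sum_apply, smul_apply,
    rankOne_apply, inner_sum, inner_smul_right]
  refine Finset.sum_congr rfl fun i _ => ?_
  rw [real_inner_comm x]; ring

/-- The pairs `(A, P)` of operators such that `A` is symmetric and the block operator
`[[A, 1], [1, P]]` is nonnegative; for invertible `A` this says that `P ≥ A⁻¹`. -/
def inverseEpigraph (E : Type*) [NormedAddCommGroup E] [InnerProductSpace ℝ E] :
    Set ((E →L[ℝ] E) × (E →L[ℝ] E)) :=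
  {p | (∀ x y, inner ℝ (p.1 x) y = inner ℝ x (p.1 y)) ∧
    ∀ x y, 0 ≤ inner ℝ x (p.1 x) + 2 * inner ℝ x y + inner ℝ y (p.2 y)}

theorem convex_inverseEpigraph : Convex ℝ (inverseEpigraph E) := by
  rintro p ⟨hp, hp'⟩ q ⟨hq, hq'⟩ a b ha hb hab
  refine ⟨fun x y => ?_, fun x y => ?_⟩
  · simp [inner_add_left, inner_add_right, inner_smul_left, inner_smul_right, hp, hq]
  · have h1 := mul_nonneg ha (hp' x y)
    have h2 := mul_nonneg hb (hq' x y)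
    obtain rfl : b = 1 - a := by linarith
    simp only [Prod.fst_add, Prod.smul_fst, Prod.snd_add, Prod.smul_snd,
      add_apply, smul_apply, inner_add_right,
      inner_smul_right]
    linarith

/-- In each coordinate the block form is a completed square, `a⁻¹ (x + a y)²`. -/
theorem diagonalOperator_mem_inverseEpigraph (u : OrthonormalBasis ι ℝ E) {a : ι → ℝ}
    (ha : ∀ i, 0 < a i) :
    (diagonalOperator u fun i => (a i)⁻¹, diagonalOperator u a) ∈ inverseEpigraph E := by
  refine ⟨fun x y => ?_, fun x y => ?_⟩
  · rw [real_inner_comm, inner_diagonalOperator, inner_diagonalOperator]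
    exact Finset.sum_congr rfl fun i _ => by ring
  · simp only [inner_diagonalOperator]
    rw [← u.sum_inner_mul_inner x y, Finset.mul_sum, ← Finset.sum_add_distrib,
      ← Finset.sum_add_distrib]
    refine Finset.sum_nonneg fun i _ => ?_
    have := (ha i).ne'
    rw [real_inner_comm (u i) x]
    have : (a i)⁻¹ * (inner ℝ (u i) x * inner ℝ (u i) x)
        + 2 * (inner ℝ (u i) x * inner ℝ (u i) y) + a i * (inner ℝ (u i) y * inner ℝ (u i) y)
        = (a i)⁻¹ * (inner ℝ (u i) x + a i * inner ℝ (u i) y) ^ 2 := by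
      field_simp; ring
    have h := ha i
    rw [this]; positivity

/-! ### Covariances and their eigenvalues -/

/-- The closed convex hull of the rank-one operators `x ⊗ x`, `x ∈ K`. -/
noncomputable def covarianceHull (K : Set E) : Set (E →L[ℝ] E) :=
  closure (convexHull ℝ ((fun x => rankOne ℝ x x) '' K))

theorem rankOne_mem_covarianceHull {K : Set E} {x : E} (hx : x ∈ K) :
    rankOne ℝ x x ∈ covarianceHull K :=
  subset_closure (subset_convexHull ℝ _ ⟨x, hx, rfl⟩)

theorem isCompact_covarianceHull [FiniteDimensional ℝ E] {K : Set E} (hK : IsCompact K) :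
    IsCompact (covarianceHull K) := by
  have hc : Continuous fun x : E => rankOne ℝ x x :=
    (rankOne ℝ).continuous.clm_apply continuous_id
  exact (isBounded_convexHull.mpr (hK.image hc).isBounded).isCompact_closure

theorem convex_covarianceHull (K : Set E) : Convex ℝ (covarianceHull K) :=
  (convex_convexHull ℝ _).closure

theorem isSymmetric_of_mem_covarianceHull {K : Set E} {S : E →L[ℝ] E} (hS : S ∈ covarianceHull K) :
    (S : E →ₗ[ℝ] E).IsSymmetric := by
  suffices covarianceHull K ⊆ {S | ∀ x y, inner ℝ (S x) y = inner ℝ x (S y)} from this hS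
  refine closure_minimal (convexHull_min ?_ ?_) ?_
  · rintro _ ⟨z, -, rfl⟩ x y
    simp [inner_smul_left, inner_smul_right, real_inner_comm, mul_comm]
  · intro S hS T hT a b _ _ _ x y
    simp [inner_add_left, inner_add_right, inner_smul_left, inner_smul_right, hS x y, hT x y]
  · simp only [Set.ofPred_forall]
    exact isClosed_iInter fun x => isClosed_iInter fun y => isClosed_eq (by fun_prop) (by fun_prop)

/-- A linear functional bounded on all `x ⊗ x`, `x ∈ K`, is bounded on `covarianceHull K`. -/
theorem le_of_mem_covarianceHull [FiniteDimensional ℝ E] {K : Set E}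
    (φ : (E →L[ℝ] E) →ₗ[ℝ] ℝ) {c : ℝ} (h : ∀ x ∈ K, φ (rankOne ℝ x x) ≤ c) {S : E →L[ℝ] E} (hS : S ∈ covarianceHull K) :
    φ S ≤ c := by
  suffices covarianceHull K ⊆ {S | φ S ≤ c} from this hS
  refine closure_minimal (convexHull_min ?_ (convex_halfSpace_le φ.isLinear c)) ?_
  · rintro _ ⟨z, hz, rfl⟩
    exact h z hz
  · exact isClosed_le φ.continuous_of_finiteDimensional continuous_const

theorem inner_nonneg_of_mem_covarianceHull [FiniteDimensional ℝ E] {K : Set E} {S : E →L[ℝ] E}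
    (hS : S ∈ covarianceHull K) (v : E) : 0 ≤ inner ℝ v (S v) := by
  let φ : (E →L[ℝ] E) →ₗ[ℝ] ℝ :=
    { toFun := fun S => -inner ℝ v (S v)
      map_add' := fun S T => by simp [inner_add_right]; ring
      map_smul' := fun a S => by simp [inner_smul_right] }
  have := le_of_mem_covarianceHull φ (c := 0) (K := K) (fun x _ => by
    simp only [φ, LinearMap.coe_mk, AddHom.coe_mk, rankOne_apply, inner_smul_right]
    rw [real_inner_comm x v]
    nlinarith [mul_self_nonneg (inner ℝ x v)]) hS
  simpa [φ] using this

/-- Covariances of points of `K` have small trace on subspaces to which `K` projects with small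
radius. -/
theorem sum_mul_sq_norm_starProjection_le [FiniteDimensional ℝ E] {K : Set E} {S : E →L[ℝ] E}
    (hS : S ∈ covarianceHull K) (W : Submodule ℝ E) {R : ℝ}
    (hR : ∀ x ∈ K, ‖W.starProjection x‖ ≤ R) (u : OrthonormalBasis ι ℝ E) {l : ι → ℝ}
    (hl : ∀ i, S (u i) = l i • u i) :
    ∑ i, l i * ‖W.starProjection (u i)‖ ^ 2 ≤ R ^ 2 := by
  have hP (x : E) : inner ℝ (W.starProjection x) x = ‖W.starProjection x‖ ^ 2 := by
    rw [← real_inner_self_eq_norm_sq, W.inner_starProjection_left_eq_right x (W.starProjection x),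
      W.starProjection_eq_self_iff.mpr (W.starProjection_apply_mem _), real_inner_comm]
  let φ : (E →L[ℝ] E) →ₗ[ℝ] ℝ :=
    { toFun := fun S => ∑ i, inner ℝ (W.starProjection (u i)) (S (u i))
      map_add' := fun S T => by simp [inner_add_right, Finset.sum_add_distrib]
      map_smul' := fun a S => by simp [inner_smul_right, Finset.mul_sum] }
  have key := le_of_mem_covarianceHull φ (c := R ^ 2) (K := K) (fun x hx => by
    have : φ (rankOne ℝ x x) = inner ℝ x (W.starProjection x) := by
      rw [← u.sum_inner_mul_inner]
      simp only [φ, LinearMap.coe_mk, AddHom.coe_mk, rankOne_apply, inner_smul_right]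
      refine Finset.sum_congr rfl fun i _ => ?_
      rw [W.inner_starProjection_left_eq_right, real_inner_comm]
    rw [this, real_inner_comm, hP]
    exact pow_le_pow_left₀ (norm_nonneg _) (hR x hx) 2) hS
  simpa [φ, hl, inner_smul_right, hP] using key

/-- The weights `‖Π_W u_m‖²` are at most 1 and sum to `dim W = n + 1 - j`. The `n - 1 - i` indices
after `i` absorb at most that much, so those up to `i` carry at least `i + 2 - j`, each with
eigenvalue at least `l i`. -/
theorem eigenvalue_mul_le [FiniteDimensional ℝ E] {n : ℕ} {K : Set E} {S : E →L[ℝ] E}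
    (hS : S ∈ covarianceHull K) (W : Submodule ℝ E) {R : ℝ}
    (hR : ∀ x ∈ K, ‖W.starProjection x‖ ≤ R) (u : OrthonormalBasis (Fin n) ℝ E) {l : Fin n → ℝ}
    (hl : ∀ i, S (u i) = l i • u i) (hl0 : ∀ i, 0 ≤ l i) (hanti : Antitone l) {j : ℕ}
    (hj : Module.finrank ℝ W + j = n + 1) (i : Fin n) :
    l i * (i + 2 - j) ≤ R ^ 2 := by
  refine le_trans ?_ (sum_mul_sq_norm_starProjection_le hS W hR u hl)
  set p : Fin n → ℝ := fun m => ‖W.starProjection (u m)‖ ^ 2 with hp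
  have hp0 m : 0 ≤ p m := by positivity
  have hp1 m : p m ≤ 1 := by
    have := W.norm_starProjection_apply_le (u m)
    rw [u.norm_eq_one] at this
    exact pow_le_one₀ (norm_nonneg _) this
  have hsum : ∑ m, p m = Module.finrank ℝ W := u.sum_sq_norm_starProjection W
  have hsplit := Finset.sum_filter_add_sum_filter_not Finset.univ (fun m => m ≤ i) p
  have htail : ∑ m with ¬ m ≤ i, p m ≤ n - 1 - i := by
    refine (Finset.sum_le_card_nsmul _ _ 1 fun m _ => hp1 m).trans_eq ?_
    have : (Finset.univ.filter fun m => ¬ m ≤ i) = Finset.Ioi i := by ext; simp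
    have hi : n = n - 1 - i + i + 1 := by have := i.isLt; omega
    rw [this, Fin.card_Ioi, nsmul_one]
    have hi' : (n : ℝ) = (n - 1 - i : ℕ) + i + 1 := by exact_mod_cast hi
    linarith
  have hj' : (Module.finrank ℝ W : ℝ) + j = n + 1 := by exact_mod_cast hj
  calc l i * (i + 2 - j) ≤ l i * ∑ m with m ≤ i, p m :=
        mul_le_mul_of_nonneg_left (by linarith) (hl0 i)
    _ = ∑ m with m ≤ i, l i * p m := Finset.mul_sum ..
    _ ≤ ∑ m with m ≤ i, l m * p m := Finset.sum_le_sum fun m hm =>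
        mul_le_mul_of_nonneg_right (hanti (Finset.mem_filter.mp hm).2) (hp0 m)
    _ ≤ ∑ m, l m * p m := Finset.sum_le_sum_of_subset_of_nonneg (Finset.filter_subset _ _)
        fun m _ _ => mul_nonneg (hl0 m) (hp0 m)

/-! ### The dual problem for a single covariance -/

/-- If `∑ √(l i) < c / 2` for the eigenvalues `l i` of `S`, there is `(A, P)` in the inverse
epigraph with `tr (S A) + tr P < c`. -/
theorem exists_mem_inverseEpigraph_trace_lt (u : OrthonormalBasis ι ℝ E)
    {S : E →L[ℝ] E} {l : ι → ℝ} (hl : ∀ i, S (u i) = l i • u i) (hl0 : ∀ i, 0 ≤ l i) {c : ℝ}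
    (hc : 2 * ∑ i, √(l i) < c) :
    ∃ p ∈ inverseEpigraph E, LinearMap.trace ℝ E (S ∘ₗ (p.1 : E →ₗ[ℝ] E)) +
      LinearMap.trace ℝ E (p.2 : E →ₗ[ℝ] E) < c := by
  -- The optimal `P = √S` may be singular; the shift by `d` makes it invertible within the slack in
  -- `hc`.
  obtain ⟨d, hd, hdc⟩ : ∃ d > 0, 2 * ∑ i, √(l i) + Fintype.card ι * d < c := by
    refine ⟨(c - 2 * ∑ i, √(l i)) / (Fintype.card ι + 1), by
      apply div_pos <;> [linarith; positivity], ?_⟩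
    have h : (0 : ℝ) < Fintype.card ι + 1 := by positivity
    rw [mul_div_assoc', ← lt_sub_iff_add_lt', div_lt_iff₀ h]
    nlinarith
  have ha i : 0 < √(l i) + d := by positivity
  refine ⟨_, diagonalOperator_mem_inverseEpigraph u ha, lt_of_le_of_lt ?_ hdc⟩
  rw [LinearMap.trace_eq_sum_inner _ u, LinearMap.trace_eq_sum_inner _ u]
  simp only [LinearMap.comp_apply, ContinuousLinearMap.coe_coe, diagonalOperator_apply_basis,
    map_smul, hl, inner_smul_right, real_inner_self_eq_norm_sq, u.norm_eq_one]
  have h1 : ∑ i, (√(l i) + d)⁻¹ * (l i * 1 ^ 2) ≤ ∑ i, √(l i) := by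
    refine Finset.sum_le_sum fun i _ => ?_
    rw [inv_mul_le_iff₀ (ha i)]
    nlinarith [Real.mul_self_sqrt (hl0 i), Real.sqrt_nonneg (l i)]
  have h2 : ∑ i, (√(l i) + d) * 1 ^ 2 = ∑ i, √(l i) + Fintype.card ι * d := by
    simp [Finset.sum_add_distrib]
  exact (add_le_add h1 h2.le).trans_eq (by ring)

/-- The pairing `(S, (A, P)) ↦ tr (S A)`. -/
noncomputable def tracePairing (E : Type*) [NormedAddCommGroup E] [InnerProductSpace ℝ E] :
    (E →L[ℝ] E) →ₗ[ℝ] ((E →L[ℝ] E) × (E →L[ℝ] E)) →ₗ[ℝ] ℝ :=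
  LinearMap.mk₂ ℝ (fun S p => LinearMap.trace ℝ E ((S : E →ₗ[ℝ] E) ∘ₗ (p.1 : E →ₗ[ℝ] E)))
    (fun S T p => by simp [LinearMap.add_comp]) (fun a S p => by simp [LinearMap.smul_comp])
    (fun S p q => by simp [LinearMap.comp_add]) (fun a S p => by simp [LinearMap.comp_smul])

/-- The functional `(A, P) ↦ tr P`. -/
noncomputable def traceSnd (E : Type*) [NormedAddCommGroup E] [InnerProductSpace ℝ E] :
    ((E →L[ℝ] E) × (E →L[ℝ] E)) →ₗ[ℝ] ℝ where
  toFun p := LinearMap.trace ℝ E (p.2 : E →ₗ[ℝ] E)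
  map_add' p q := by simp
  map_smul' a p := by simp

theorem trace_rankOne_comp [FiniteDimensional ℝ E] (x : E) (A : E →L[ℝ] E) :
    LinearMap.trace ℝ E ((rankOne ℝ x x : E →L[ℝ] E) ∘ₗ (A : E →ₗ[ℝ] E)) = inner ℝ x (A x) := by
  rw [LinearMap.trace_comp_comm']
  have : (A : E →ₗ[ℝ] E) ∘ₗ ((rankOne ℝ x x : E →L[ℝ] E) : E →ₗ[ℝ] E)
      = (rankOne ℝ (A x) x : E →L[ℝ] E) := by ext; simp
  rw [this, InnerProductSpace.trace_rankOne]

end InnerProduct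

/-! ### Widths, ellipsoids and eigenvalue decay -/

theorem le_projRadius {n : ℕ} {K : Set (EuclideanSpace ℝ (Fin n))} (hK : IsCompact K)
    (W : Submodule ℝ (EuclideanSpace ℝ (Fin n))) {x : EuclideanSpace ℝ (Fin n)} (hx : x ∈ K) :
    ‖W.starProjection x‖ ≤ projRadius K W :=
  le_csSup (hK.image (by fun_prop)).bddAbove ⟨x, hx, rfl⟩

theorem projRadius_nonneg {n : ℕ} (K : Set (EuclideanSpace ℝ (Fin n)))
    (W : Submodule ℝ (EuclideanSpace ℝ (Fin n))) : 0 ≤ projRadius K W :=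
  Real.sSup_nonneg (by rintro _ ⟨x, -, rfl⟩; exact norm_nonneg _)

theorem le_kolmogorovWidth {n k : ℕ} (hk : k ∈ Finset.Icc 1 n) {K : Set (EuclideanSpace ℝ (Fin n))}
    {r : ℝ} (h : ∀ W : Submodule ℝ (EuclideanSpace ℝ (Fin n)),
      Module.finrank ℝ W + k = n + 1 → r ≤ projRadius K W) : r ≤ kolmogorovWidth k K := by
  rw [Finset.mem_Icc] at hk
  -- The family of subspaces must be nonempty: the real infimum of the empty set is 0.
  obtain ⟨W, hW⟩ : ∃ W : Submodule ℝ (EuclideanSpace ℝ (Fin n)),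
      Module.finrank ℝ W = n + 1 - k := by
    have hli := (EuclideanSpace.basisFun (Fin n) ℝ).toBasis.linearIndependent.comp
      (Fin.castLE (show n + 1 - k ≤ n by omega)) (Fin.castLE_injective _)
    exact ⟨_, (finrank_span_eq_card hli).trans (Fintype.card_fin _)⟩
  refine le_csInf ⟨_, W, ?_, rfl⟩ ?_
  · change Module.finrank ℝ W + k = n + 1
    omega
  · rintro _ ⟨W, hW, rfl⟩
    exact h W hW

/-- The points `x` with `⟪x, A x⟫ ≤ s` lie in an ellipsoid `F B` with `‖F‖² ≤ s tr P`. -/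
theorem exists_ellipsoid_of_mem_inverseEpigraph {n : ℕ}
    {p : (EuclideanSpace ℝ (Fin n) →L[ℝ] EuclideanSpace ℝ (Fin n)) ×
      (EuclideanSpace ℝ (Fin n) →L[ℝ] EuclideanSpace ℝ (Fin n))}
    (hp : p ∈ inverseEpigraph (EuclideanSpace ℝ (Fin n))) {s : ℝ} (hs : 0 < s) :
    ∃ F : Matrix (Fin n) (Fin n) ℝ, {x | inner ℝ x (p.1 x) ≤ s} ⊆ ellipsoid F ∧
      ‖F‖ ^ 2 ≤ s * LinearMap.trace ℝ _ (p.2 : EuclideanSpace ℝ (Fin n) →ₗ[ℝ] _) := by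
  obtain ⟨A, P⟩ := p
  obtain ⟨hA, hAP⟩ := hp
  replace hA : (A : EuclideanSpace ℝ (Fin n) →ₗ[ℝ] EuclideanSpace ℝ (Fin n)).IsSymmetric := hA
  have hn : Module.finrank ℝ (EuclideanSpace ℝ (Fin n)) = n := by simp
  set u := hA.eigenvectorBasis hn
  set a := hA.eigenvalues hn
  have hAu i : A (u i) = a i • u i := hA.apply_eigenvectorBasis hn i
  have hq i (t : ℝ) : 0 ≤ a i * (t * t) + 2 * t + inner ℝ (u i) (P (u i)) := by
    have := hAP (t • u i) (u i)
    simp only [map_smul, hAu, inner_smul_left, inner_smul_right, real_inner_self_eq_norm_sq,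
      u.norm_eq_one, RCLike.conj_to_real] at this
    linarith
  have ha i : 0 < a i := by
    by_contra! h
    have := hq i (-(|inner ℝ (u i) (P (u i))| + 1))
    have := le_abs_self (inner ℝ (u i) (P (u i)))
    nlinarith [mul_self_nonneg (|inner ℝ (u i) (P (u i))| + 1),
      abs_nonneg (inner ℝ (u i) (P (u i)))]
  -- The quadratic in `hq` is minimal at `t = -1 / a i`.
  have hPi i : (a i)⁻¹ ≤ inner ℝ (u i) (P (u i)) := by
    have h := hq i (-(a i)⁻¹)
    have := (ha i).ne'
    have h2 : a i * (-(a i)⁻¹ * -(a i)⁻¹) = (a i)⁻¹ := by field_simp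
    linarith
  refine ⟨Matrix.of fun m i => √(s / a i) * u i m, fun x hx => ?_, ?_⟩
  · have hsa i : 0 < √(s / a i) := Real.sqrt_pos.mpr (div_pos hs (ha i))
    refine ⟨WithLp.toLp 2 fun i => inner ℝ (u i) x / √(s / a i), ?_, ?_⟩
    · rw [mem_closedBall_zero_iff, ← sq_le_one_iff₀ (norm_nonneg _), EuclideanSpace.norm_sq_eq]
      have hxA : ∑ i, a i * inner ℝ (u i) x ^ 2 ≤ s := by
        refine le_trans (le_of_eq ?_) (show inner ℝ x (A x) ≤ s from hx)
        rw [← u.sum_inner_mul_inner x (A x)]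
        refine Finset.sum_congr rfl fun i _ => ?_
        have := hA (u i) x
        simp only [ContinuousLinearMap.coe_coe, hAu, inner_smul_left, RCLike.conj_to_real] at this
        rw [← this, real_inner_comm]
        ring
      calc ∑ i, ‖inner ℝ (u i) x / √(s / a i)‖ ^ 2 = (∑ i, a i * inner ℝ (u i) x ^ 2) / s := by
            rw [Finset.sum_div]
            refine Finset.sum_congr rfl fun i _ => ?_
            rw [Real.norm_eq_abs, sq_abs, div_pow, Real.sq_sqrt (div_pos hs (ha i)).le]
            have := (ha i).ne'
            field_simp
        _ ≤ 1 := (div_le_one hs).mpr hxA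
    · ext m
      have := congrArg (fun y => y.ofLp m) (u.sum_repr' x)
      simp only [WithLp.ofLp_sum, Finset.sum_apply, PiLp.smul_apply, smul_eq_mul] at this
      rw [← this]
      simp only [Matrix.toEuclideanLin, Matrix.ofLp_toLpLin, Matrix.toLin'_apply, Matrix.mulVec, dotProduct, Matrix.of_apply]
      refine Finset.sum_congr rfl fun i _ => ?_
      have := (hsa i).ne'
      field_simp
  · rw [Matrix.frobenius_norm_def, ← Real.sqrt_eq_rpow, Real.sq_sqrt (by positivity),
      Finset.sum_comm, LinearMap.trace_eq_sum_inner _ u, Finset.mul_sum]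
    refine Finset.sum_le_sum fun i _ => ?_
    have h1 : ∑ m, ‖u i m‖ ^ 2 = 1 := by
      rw [← EuclideanSpace.norm_sq_eq, u.norm_eq_one, one_pow]
    calc ∑ m, ‖√(s / a i) * u i m‖ ^ (2 : ℝ) = s / a i * ∑ m, ‖u i m‖ ^ 2 := by
          rw [Finset.mul_sum]
          refine Finset.sum_congr rfl fun m _ => ?_
          rw [Real.rpow_two, norm_mul, mul_pow, Real.norm_eq_abs √_, sq_abs,
            Real.sq_sqrt (div_pos hs (ha i)).le]
      _ ≤ s * inner ℝ (u i) (P (u i)) := by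
          rw [h1, mul_one, div_eq_mul_inv]
          exact mul_le_mul_of_nonneg_left (hPi i) hs.le

/-- The square roots of the decreasing eigenvalues of a covariance of points of `K` are dominated
by the harmonic series, with constant controlled by the maximum of `√k d_k(K)`. -/
theorem sqrt_eigenvalue_le {n : ℕ} {K : Set (EuclideanSpace ℝ (Fin n))} (hK : IsCompact K)
    {M : ℝ} (hM : ∀ k ∈ Finset.Icc 1 n, √(k : ℝ) * kolmogorovWidth k K ≤ M)
    {S : EuclideanSpace ℝ (Fin n) →L[ℝ] EuclideanSpace ℝ (Fin n)} (hS : S ∈ covarianceHull K)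
    (u : OrthonormalBasis (Fin n) ℝ (EuclideanSpace ℝ (Fin n))) {l : Fin n → ℝ}
    (hl : ∀ i, S (u i) = l i • u i) (hl0 : ∀ i, 0 ≤ l i) (hanti : Antitone l) (i : Fin n) :
    √(l i) ≤ 2 * M * ((i : ℝ) + 1)⁻¹ := by
  -- With `i` counted from 0, `j` is half of `i + 1` rounded up, so both `j` and `i + 2 - j` are at
  -- least `(i + 1) / 2`.
  set j : ℕ := (i + 2) / 2 with hj
  have hjn : j ∈ Finset.Icc 1 n := by rw [Finset.mem_Icc]; omega
  have hj1 : (i + 1 : ℝ) ≤ 2 * j := by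
    have : (i : ℕ) + 1 ≤ 2 * j := by omega
    exact_mod_cast this
  have hj2 : (2 * j : ℝ) ≤ i + 2 := by
    have : 2 * j ≤ (i : ℕ) + 2 := by omega
    exact_mod_cast this
  have hi : (0 : ℝ) ≤ i := Nat.cast_nonneg _
  have hw : √(l i * ((i + 1) / 2)) ≤ kolmogorovWidth j K := by
    refine le_kolmogorovWidth hjn fun W hW => Real.sqrt_le_iff.mpr ⟨projRadius_nonneg K W, ?_⟩
    refine le_trans (mul_le_mul_of_nonneg_left ?_ (hl0 i))
      (eigenvalue_mul_le hS W (fun x hx => le_projRadius hK W hx) u hl hl0 hanti hW i)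
    linarith
  rw [← div_eq_mul_inv, le_div_iff₀ (by positivity)]
  have h1 : √((i + 1) / 2 : ℝ) ≤ √(j : ℝ) := Real.sqrt_le_sqrt (by linarith)
  have h2 : √((i + 1) / 2 : ℝ) * √(l i * ((i + 1) / 2)) ≤ M :=
    le_trans (mul_le_mul h1 hw (Real.sqrt_nonneg _) (Real.sqrt_nonneg _)) (hM j hjn)
  rw [Real.sqrt_mul (hl0 i), mul_left_comm, Real.mul_self_sqrt (by positivity)] at h2
  linarith

theorem sum_inv_le_log {n : ℕ} (hn : 2 ≤ n) : ∑ i : Fin n, ((i : ℝ) + 1)⁻¹ ≤ 3 * Real.log n := by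
  have h := harmonic_le_one_add_log n
  have h2 : Real.log 2 ≤ Real.log n := Real.log_le_log two_pos (by exact_mod_cast hn)
  have h3 := Real.log_two_gt_d9
  rw [Fin.sum_univ_eq_sum_range (fun i => ((i : ℝ) + 1)⁻¹)]
  simp only [harmonic, Rat.cast_sum, Rat.cast_inv, Rat.cast_natCast, Nat.cast_add,
    Nat.cast_one, Rat.cast_add, Rat.cast_one] at h
  linarith

theorem norm_le_kolmogorovWidth_one {n : ℕ} (hn : 1 ≤ n) {K : Set (EuclideanSpace ℝ (Fin n))}
    (hK : IsCompact K) {x : EuclideanSpace ℝ (Fin n)} (hx : x ∈ K) : ‖x‖ ≤ kolmogorovWidth 1 K := by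
  refine le_kolmogorovWidth (Finset.mem_Icc.mpr ⟨le_rfl, hn⟩) fun W hW => ?_
  have : W = ⊤ := Submodule.eq_top_of_finrank_eq (by simpa using hW)
  have h := le_projRadius hK W hx
  rwa [W.starProjection_eq_self_iff.mpr (this ▸ Submodule.mem_top)] at h

/-! ### Minimax and conclusion -/

theorem exists_ellipsoid_of_sqrt_mul_kolmogorovWidth_le {n : ℕ} (hn : 2 ≤ n)
    {K : Set (EuclideanSpace ℝ (Fin n))} (hK : IsCompact K) (hKn : K.Nonempty) {M : ℝ}
    (hM0 : 0 < M) (hM : ∀ k ∈ Finset.Icc 1 n, √(k : ℝ) * kolmogorovWidth k K ≤ M) :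
    ∃ F : Matrix (Fin n) (Fin n) ℝ, K ⊆ ellipsoid F ∧ ‖F‖ ≤ 7 * Real.log n * M := by
  have hlog : 0 < Real.log n := Real.log_pos (by exact_mod_cast hn)
  let B := tracePairing (EuclideanSpace ℝ (Fin n))
  let g := traceSnd (EuclideanSpace ℝ (Fin n))
  obtain ⟨p, hp, hlt⟩ := exists_forall_lt_of_affine B g (isCompact_covarianceHull hK)
    (hKn.elim fun x hx => ⟨_, rankOne_mem_covarianceHull hx⟩) (convex_covarianceHull K)
    -- The dual value is at most `2 · 2M · 3 log n`; 14 in place of 12 makes the inequality strict.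
    convex_inverseEpigraph (c := 14 * Real.log n * M) (fun S hS => by
      have hsym := isSymmetric_of_mem_covarianceHull hS
      have hfr : Module.finrank ℝ (EuclideanSpace ℝ (Fin n)) = n := by simp
      set u := hsym.eigenvectorBasis hfr
      set l := hsym.eigenvalues hfr
      have hl i : S (u i) = l i • u i := hsym.apply_eigenvectorBasis hfr i
      have hl0 i : 0 ≤ l i := by
        simpa [hl, inner_smul_right] using inner_nonneg_of_mem_covarianceHull hS (u i)
      refine exists_mem_inverseEpigraph_trace_lt u hl hl0 ?_
      have h1 : ∑ i, √(l i) ≤ 2 * M * ∑ i : Fin n, ((i : ℝ) + 1)⁻¹ := by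
        rw [Finset.mul_sum]
        exact Finset.sum_le_sum fun i _ => sqrt_eigenvalue_le hK hM hS u hl hl0
          (hsym.eigenvalues_antitone hfr) i
      have h2 := mul_le_mul_of_nonneg_left (sum_inv_le_log hn) (by positivity : 0 ≤ 2 * M)
      nlinarith [mul_pos hlog hM0])
  have hx (x) (hx : x ∈ K) : inner ℝ x (p.1 x) < 14 * Real.log n * M - g p := by
    have := hlt _ (rankOne_mem_covarianceHull hx)
    rw [show B (rankOne ℝ x x) p = inner ℝ x (p.1 x) from trace_rankOne_comp x p.1] at this
    linarith
  obtain ⟨x₀, hx₀⟩ := hKn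
  have hs : 0 < 14 * Real.log n * M - g p :=
    lt_of_le_of_lt (by simpa using hp.2 x₀ 0) (hx x₀ hx₀)
  obtain ⟨F, hF, hFn⟩ := exists_ellipsoid_of_mem_inverseEpigraph hp hs
  refine ⟨F, fun x hxK => hF (hx x hxK).le, abs_le_of_sq_le_sq' ?_ (by positivity) |>.2⟩
  change ‖F‖ ^ 2 ≤ (14 * Real.log n * M - g p) * g p at hFn
  -- AM-GM: the two factors sum to `14 M log n`.
  nlinarith [sq_nonneg (g p - 7 * Real.log n * M)]

theorem theorem6p1 :
    ∃ C : ℝ, 0 < C ∧ ∀ (n : ℕ) (hn : 2 ≤ n) (K : ConvexBody (EuclideanSpace ℝ (Fin n))),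
      -(K : Set (EuclideanSpace ℝ (Fin n))) = K →
      ∃ F : Matrix (Fin n) (Fin n) ℝ,
        (K : Set (EuclideanSpace ℝ (Fin n))) ⊆ ellipsoid F ∧
        ‖F‖ ≤ C * Real.log n *
          (Finset.Icc 1 n).sup' (Finset.nonempty_Icc.mpr (one_le_two.trans hn))
            (fun k => √(k : ℝ) * kolmogorovWidth k (K : Set (EuclideanSpace ℝ (Fin n)))) := by
  refine ⟨7, by norm_num, fun n hn K _ => ?_⟩
  have hM : ∀ k ∈ Finset.Icc 1 n, √(k : ℝ) * kolmogorovWidth k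
      (K : Set (EuclideanSpace ℝ (Fin n))) ≤
        (Finset.Icc 1 n).sup' (Finset.nonempty_Icc.mpr (one_le_two.trans hn))
          (fun k => √(k : ℝ) * kolmogorovWidth k (K : Set (EuclideanSpace ℝ (Fin n)))) :=
    fun k hk => Finset.le_sup' (fun k : ℕ => √(k : ℝ) *
      kolmogorovWidth k (K : Set (EuclideanSpace ℝ (Fin n)))) hk
  generalize (Finset.Icc 1 n).sup' (α := ℝ) _ _ = M at hM ⊢
  have hnorm (x) (hx : x ∈ (K : Set (EuclideanSpace ℝ (Fin n)))) : ‖x‖ ≤ M := by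
    refine (norm_le_kolmogorovWidth_one (by omega) K.isCompact hx).trans ?_
    simpa using hM 1 (Finset.mem_Icc.mpr ⟨le_rfl, by omega⟩)
  obtain ⟨x₀, hx₀⟩ := K.nonempty
  -- If `M = 0` then `K` is the origin, and the strict bounds of the minimax argument are
  -- unavailable.
  rcases ((norm_nonneg x₀).trans (hnorm x₀ hx₀)).eq_or_lt with h0 | hpos
  · refine ⟨0, fun x hx => ⟨0, by simp, ?_⟩, by simp [← h0]⟩
    have : x = 0 := norm_le_zero_iff.mp (h0 ▸ hnorm x hx)
    simp [this]
  · exact exists_ellipsoid_of_sqrt_mul_kolmogorovWidth_le hn K.isCompact K.nonempty hpos hM
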